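/- Let $R$ be a discrete valuation ring with fraction field $K$ and residue field $\kappa$, and let $v:K\to\mathbb{Z}\cup\{\infty\}$ be its normalized valuation, so $v(K^*)=\mathbb{Z}$ and $v(0)=\infty$. Let $E/K$ be an elliptic curve given by a Weierstrass equation $$y^2+a_1xy+a_3y=x^3+a_2x^2+a_4x+a_6$$ that is minimal with respect to $v$, and let $P=(x(P),y(P))\in E(K)\setminus\{O\}$. For $n\ge 1$ let $\psi_n^2(x),\phi_n(x)\in K[x]$ be the division polynomials of this equation, where $\psi_n$ is the $n$-th division polynomial, $\psi_n^2$ is written as a polynomial in $x$ by means of the equation, and $\phi_n=x\psi_n^2-\psi_{n-1}\psi_{n+1}$ (likewise written in $x$); put $$k_{v,n}(P)=\min\{v(\psi_n^2(x(P))),\,v(\phi_n(x(P)))\}.$$ Assume that $P$ has non-singular reduction, i.e. that $P$ reduces modulo $v$ to a non-singular point of the reduced Weierstrass curve over $\kappa$, and that $(P.O)_v:=\max\{0,-v(x(P))\}=0$, i.e. $v(x(P))\ge 0$. Then $k_{v,n}(P)=0$ for all $n\ge 1$. -/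

import Mathlib

namespace EllipticCancellation

open IsDedekindDomain IsLocalRing

noncomputable section

section Valuation

variable (R : Type*) [CommRing R] [IsDomain R] [IsDiscreteValuationRing R]
  {K : Type*} [Field K] [Algebra R K] [IsFractionRing R K]

/-- The normalized additive valuation `v : K → ℤ ∪ {∞}` of the fraction field `K` of a discrete
valuation ring `R`, with `v 0 = ∞`. It is minus the logarithm of Mathlib's multiplicative valuation
attached to the maximal ideal of `R`. -/
def val (z : K) : WithTop ℤ :=
  open scoped Classical in
  if z = 0 then ⊤
  else ((-WithZero.log
    (HeightOneSpectrum.valuation K (IsDiscreteValuationRing.maximalIdeal R) z) : ℤ) : WithTop ℤ)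

end Valuation

section Curve

variable (R : Type*) [CommRing R] [IsDomain R] [IsDiscreteValuationRing R]
  {K : Type*} [Field K] [Algebra R K] [IsFractionRing R K] (W : WeierstrassCurve K)

/-- The local intersection number `(P.O)_v = max {0, -v(x(P))}` of a point `P ≠ O` with the zero
point `O`; by convention it is `∞` for `P = O`. If `x(P) = 0` then `-v(x(P)) = -∞`, and the value
is `0`, in agreement with `WithZero.log 0 = 0`. -/
def intersectionZero : W.toAffine.Point → WithTop ℤ
  | .zero => ⊤
  | .some x _ _ => ((max 0 (WithZero.log
      (HeightOneSpectrum.valuation K (IsDiscreteValuationRing.maximalIdeal R) x)) : ℤ) : WithTop ℤ)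

/-- A point `P` on a minimal Weierstrass equation has non-singular reduction if its reduction is a
non-singular point of the reduced curve: `P = [u₀ : u₁ : u₂]` with `uᵢ ∈ R` not all in the maximal
ideal, and the point with coordinates `uᵢ` modulo the maximal ideal is a non-singular point of the
projective Weierstrass curve over the residue field. -/
def HasNonsingularReduction [W.IsMinimal R] (P : W.toAffine.Point) : Prop :=
  ∃ u : Fin 3 → R, (∃ i, IsUnit (u i)) ∧
    P.toProjective.point = ⟦fun i => algebraMap R K (u i)⟧ ∧
    (W.reduction R).toProjective.Nonsingular (fun i => residue R (u i))

/-- The cancellation exponent `k_{v,n} = min {v(ψₙ²(x)), v(φₙ(x))}` at a point with `x`-coordinate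
`x`. Here `W.ΨSq n` and `W.Φ n` are the univariate polynomials in `K[X]` that represent
`ψₙ²` and `φₙ`. -/
def cancellationExponent (n : ℕ) (x : K) : WithTop ℤ :=
  min (val R ((W.ΨSq (n : ℤ)).eval x)) (val R ((W.Φ (n : ℤ)).eval x))

end Curve

end

end EllipticCancellation

/-! ### Somos-4 relations and the addition formula over a field -/

section EllipticRecurrence

variable {F : Type*} [Field F]

/-! Since `x(P)` is integral, `P` reduces to an affine nonsingular point, so it suffices that `ΨSq
n` and `Φ n` have no common zero there over the residue field. At a common zero two consecutive
`ψ`'s vanish. The values `ψ_k` form a `normEDS` satisfying a Somos-4 relation with a conserved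
quantity `J`; together these push the vanishing down to `ψ₂ = ψ₃ = 0`, which says that both partial
derivatives vanish (`normEDS_eq_zero_of_consecutive`). The two relations are proved for generic
parameters, where no positive-index term vanishes, and then specialised. -/

lemma somos_invariant {V : ℤ → F} {b c J : F} {N : ℤ}
    (h0 : V 0 = 0) (h1 : V 1 = 1) (h2 : V 2 = b) (h3 : V 3 = c) (h4 : V 4 = (J * c - b ^ 4) * b)
    (hne : ∀ k, 1 ≤ k → k ≤ N → V k ≠ 0)
    (hS : ∀ k, 2 ≤ k → k < N →
      V (k + 2) * V (k - 2) = b ^ 2 * (V (k + 1) * V (k - 1)) - c * V k ^ 2)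
    {k : ℤ} (hk : 2 ≤ k) (hkN : k < N) :
    V (k - 1) ^ 2 * V (k + 2) + V (k + 1) ^ 2 * V (k - 2) + b ^ 2 * V k ^ 3 =
      J * (V (k - 1) * V k * V (k + 1)) := by
  induction k, hk using Int.leInduction with
  | base =>
    norm_num [h0, h1, h2, h3, h4]
    ring
  | succ k hk ih =>
    have ih := ih (by lia)
    have s := hS k hk (by lia)
    have s' := hS (k + 1) (by lia) hkN
    have e1 : k + 1 + 2 = k + 3 := by ring
    have e2 : k + 1 - 2 = k - 1 := by ring
    have e3 : k + 1 + 1 = k + 2 := by ring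
    have e4 : k + 1 - 1 = k := by ring
    rw [e1, e2, e3, e4] at s' ⊢
    -- `J` is conserved: times `V (k - 1)`, the claim at `k + 1` follows from the claim at `k` and
    -- the Somos relations at `k` and `k + 1`.
    refine mul_left_cancel₀ (hne (k - 1) (by lia) (by lia)) ?_
    linear_combination V k ^ 2 * s' + V (k + 2) * ih - V (k + 1) ^ 2 * s

/-- The top term `V (N + 1)` may vanish; this permits its use on a term not yet identified. -/
lemma somos_addition {V : ℤ → F} {b c J : F} {N : ℤ}
    (h0 : V 0 = 0) (h1 : V 1 = 1) (h2 : V 2 = b) (h3 : V 3 = c) (h4 : V 4 = (J * c - b ^ 4) * b)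
    (hne : ∀ k, 1 ≤ k → k ≤ N → V k ≠ 0)
    (hS : ∀ k, 2 ≤ k → k < N →
      V (k + 2) * V (k - 2) = b ^ 2 * (V (k + 1) * V (k - 1)) - c * V k ^ 2)
    {m n : ℤ} (hn : 1 ≤ n) (hnm : n < m) (hmn : m + n ≤ N + 1) :
    V (m + n) * V (m - n) =
      V (m + 1) * V (m - 1) * V n ^ 2 - V (n + 1) * V (n - 1) * V m ^ 2 := by
  -- On a curve, `f k = x(P) - x(kP)`.
  obtain ⟨f, hf⟩ : ∃ f : ℤ → F, ∀ k, 1 ≤ k → k ≤ N → V (k + 1) * V (k - 1) = V k ^ 2 * f k :=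
    ⟨fun k ↦ V (k + 1) * V (k - 1) / V k ^ 2, fun k hk hkN ↦ by
      have := hne k hk hkN
      field_simp⟩
  have hf1 {k : ℤ} (hk : 2 ≤ k) (hkN : k < N) :
      f (k + 1) * f (k - 1) * f k ^ 2 = b ^ 2 * f k - c := by
    have a := hne k (by lia) (by lia)
    have e := hf k (by lia) (by lia)
    have e1 := hf (k + 1) (by lia) (by lia)
    have e2 := hf (k - 1) (by lia) (by lia)
    have s := hS k hk hkN
    rw [show k + 1 + 1 = k + 2 by ring, show k + 1 - 1 = k by ring] at e1
    rw [show k - 1 - 1 = k - 2 by ring, show k - 1 + 1 = k by ring] at e2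
    rw [e] at s
    have hsq : (V k ^ 2 * f k) ^ 2 = V (k + 1) ^ 2 * V (k - 1) ^ 2 := by rw [← e]; ring
    refine mul_left_cancel₀ (pow_ne_zero 4 a) ?_
    linear_combination f (k + 1) * f (k - 1) * hsq - V (k - 1) ^ 2 * f (k - 1) * e1 -
      V (k + 2) * V k * e2 + V k ^ 2 * s
  have hf2 {k : ℤ} (hk : 2 ≤ k) (hkN : k < N) :
      (f (k + 1) + f (k - 1)) * f k ^ 2 = J * f k - b ^ 2 := by
    have a := hne k (by lia) (by lia)
    have e := hf k (by lia) (by lia)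
    have e1 := hf (k + 1) (by lia) (by lia)
    have e2 := hf (k - 1) (by lia) (by lia)
    have t := somos_invariant h0 h1 h2 h3 h4 hne hS hk hkN
    rw [show k + 1 + 1 = k + 2 by ring, show k + 1 - 1 = k by ring] at e1
    rw [show k - 1 - 1 = k - 2 by ring, show k - 1 + 1 = k by ring] at e2
    have hsq : (V k ^ 2 * f k) ^ 2 = V (k + 1) ^ 2 * V (k - 1) ^ 2 := by rw [← e]; ring
    refine mul_left_cancel₀ (pow_ne_zero 4 a) ?_
    linear_combination (f (k + 1) + f (k - 1)) * hsq - V (k - 1) ^ 2 * e1 -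
      V (k + 1) ^ 2 * e2 + V k * t + J * V k ^ 2 * e
  have key {m n : ℤ} (hm : 2 ≤ m) (hmN : m < N) (hn : 2 ≤ n) (hnN : n < N) :
      (f m - f (n + 1)) * (f m - f (n - 1)) * f n ^ 2 =
        (f (m + 1) - f n) * (f (m - 1) - f n) * f m ^ 2 := by
    -- Expanded by `hf1` and `hf2`, the left side is `f m² f n² - J f m f n + b² (f m + f n) - c`,
    -- symmetric in `m` and `n`.
    linear_combination hf1 hn hnN - f m * hf2 hn hnN - hf1 hm hmN + f n * hf2 hm hmN
  have main : ∀ n : ℕ, (∀ m : ℤ, (n : ℤ) + 1 < m → m + (n + 1) ≤ N + 1 →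
      V (m + (n + 1)) * V (m - (n + 1)) = V m ^ 2 * V (n + 1) ^ 2 * (f m - f (n + 1))) := by
    intro n
    induction n using Nat.strong_induction_on with
    | _ n ih =>
    intro m hm hmN
    match n with
    | 0 =>
      have e := hf m (by lia) (by lia)
      have e1 := hf 1 (by lia) (by lia)
      norm_num [h0, h1] at e1 ⊢
      rw [e, ← e1, sub_zero]
    | 1 =>
      have e := hf m (by lia) (by lia)
      have e1 := hf 2 (by lia) (by lia)
      have s := hS m (by lia) (by lia)
      norm_num [h1, h2, h3] at e1 ⊢
      linear_combination s + b ^ 2 * e - V m ^ 2 * e1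
    | n + 2 =>
      have d0 := ih n (by lia) m (by lia) (by lia)
      have d1 := ih (n + 1) (by lia) (m + 1) (by lia) (by lia)
      have d2 := ih (n + 1) (by lia) (m - 1) (by lia) (by lia)
      push_cast at *
      have k := key (m := m) (n := n + 2) (by lia) (by lia) (by lia) (by lia)
      have em := hf m (by lia) (by lia)
      have en := hf (n + 2) (by lia) (by lia)
      rw [show (n : ℤ) + 2 + 1 = n + 3 by ring, show (n : ℤ) + 2 - 1 = n + 1 by ring] at k en
      rw [show m + 1 + ((n : ℤ) + 1 + 1) = m + (n + 3) by ring,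
        show m + 1 - ((n : ℤ) + 1 + 1) = m - (n + 1) by ring,
        show (n : ℤ) + 1 + 1 = n + 2 by ring] at d1
      rw [show m - 1 + ((n : ℤ) + 1 + 1) = m + (n + 1) by ring,
        show m - 1 - ((n : ℤ) + 1 + 1) = m - (n + 3) by ring,
        show (n : ℤ) + 1 + 1 = n + 2 by ring] at d2
      rw [show (n : ℤ) + 2 + 1 = n + 3 by ring]
      have hmsq : (V m ^ 2 * f m) ^ 2 = V (m + 1) ^ 2 * V (m - 1) ^ 2 := by rw [← em]; ring
      have hnsq : (V (n + 2) ^ 2 * f (n + 2)) ^ 2 = V (n + 3) ^ 2 * V (n + 1) ^ 2 := by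
        rw [← en]; ring
      refine mul_left_cancel₀ (mul_ne_zero (hne (m + (n + 1)) (by lia) (by lia))
        (hne (m - (n + 1)) (by lia) (by lia))) ?_
      -- The product of the cases `(m ± 1, n + 2)`, divided by the case `(m, n + 1)`, gives `(m, n +
      -- 3)`.
      calc _ = V (m + (n + 3)) * V (m - (n + 1)) * (V (m + (n + 1)) * V (m - (n + 3))) := by ring
        _ = V (m + 1) ^ 2 * V (m - 1) ^ 2 * V (n + 2) ^ 4 *
            ((f (m + 1) - f (n + 2)) * (f (m - 1) - f (n + 2))) := by rw [d1, d2]; ring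
        _ = V m ^ 4 * V (n + 2) ^ 4 *
            ((f (m + 1) - f (n + 2)) * (f (m - 1) - f (n + 2)) * f m ^ 2) := by
          rw [← hmsq]; ring
        _ = V m ^ 4 * (V (n + 3) ^ 2 * V (n + 1) ^ 2) *
            ((f m - f (n + 3)) * (f m - f (n + 1))) := by rw [← k, ← hnsq]; ring
        _ = _ := by rw [d0]; ring
  obtain ⟨n, rfl⟩ : ∃ l : ℕ, n = l + 1 := ⟨(n - 1).toNat, by lia⟩
  rw [main n m hnm hmn, hf m (by lia) (by lia), hf (n + 1) (by lia) (by lia)]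
  ring

lemma normEDS_somos_of_ne_zero {b c J : F} (hne : ∀ k : ℤ, 1 ≤ k → normEDS b c (J * c - b ^ 4) k ≠ 0)
    (k : ℤ) (hk : 2 ≤ k) :
    normEDS b c (J * c - b ^ 4) (k + 2) * normEDS b c (J * c - b ^ 4) (k - 2) =
      b ^ 2 * (normEDS b c (J * c - b ^ 4) (k + 1) * normEDS b c (J * c - b ^ 4) (k - 1)) -
        c * normEDS b c (J * c - b ^ 4) k ^ 2 := by
  set W := normEDS b c (J * c - b ^ 4) with hW
  have hb : b ≠ 0 := by simpa [W] using hne 2 (by lia)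
  suffices ∀ N : ℕ, ∀ k : ℤ, 2 ≤ k → k ≤ N + 2 →
      W (k + 2) * W (k - 2) = b ^ 2 * (W (k + 1) * W (k - 1)) - c * W k ^ 2 from
    this (k - 2).toNat k hk (by lia)
  intro N
  induction N with
  | zero =>
    intro k hk hk2
    obtain rfl : k = 2 := by lia
    norm_num [W]
    ring
  | succ N ih =>
    intro k hk hkN
    rcases lt_or_ge k (N + 3) with h | h
    · exact ih k hk (by lia)
    obtain rfl : k = N + 3 := by push_cast at hkN; lia
    -- `z` is the value the Somos relation forces at `N + 5`. The addition formula for the modified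
    -- sequence shows that `z` obeys the doubling recursion defining `W`, so `z = W (N + 5)`.
    set z := (b ^ 2 * (W (N + 4) * W (N + 2)) - c * W (N + 3) ^ 2) / W (N + 1)
    have hzmul : z * W (N + 1) = b ^ 2 * (W (N + 4) * W (N + 2)) - c * W (N + 3) ^ 2 :=
      div_mul_cancel₀ _ (hne _ (by lia))
    set V : ℤ → F := Function.update W (N + 5) z
    have hVW {j : ℤ} (hj : j < N + 5) : V j = W j := Function.update_of_ne hj.ne _ _
    have hVz : V (N + 5) = z := Function.update_self ..
    have hVS (k : ℤ) (hk : 2 ≤ k) (hkN : k < (N + 4 : ℤ)) :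
        V (k + 2) * V (k - 2) = b ^ 2 * (V (k + 1) * V (k - 1)) - c * V k ^ 2 := by
      rw [hVW (j := k - 2) (by lia), hVW (j := k + 1) (by lia), hVW (j := k - 1) (by lia),
        hVW (j := k) (by lia)]
      rcases lt_or_ge k (N + 3) with h | h
      · rw [hVW (by lia), ih k hk (by lia)]
      · obtain rfl : k = N + 3 := by lia
        rw [show (N : ℤ) + 3 + 2 = N + 5 by ring, show (N : ℤ) + 3 - 2 = N + 1 by ring,
          show (N : ℤ) + 3 + 1 = N + 4 by ring, show (N : ℤ) + 3 - 1 = N + 2 by ring, hVz, hzmul]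
    have hD {m n : ℤ} (hn : 2 ≤ n) (hnm : n < m) (hmn : m + n = N + 5) :
        z * W (m - n) = W (m + 1) * W (m - 1) * W n ^ 2 - W (n + 1) * W (n - 1) * W m ^ 2 := by
      have := somos_addition (V := V) (b := b) (c := c) (J := J) (N := N + 4)
        (by rw [hVW (by lia)]; simp [W]) (by rw [hVW (by lia)]; simp [W])
        (by rw [hVW (by lia)]; simp [W]) (by rw [hVW (by lia)]; simp [W])
        (by rw [hVW (by lia)]; simp [W]) (fun k h1 h2 ↦ by rw [hVW (by lia)]; exact hne k h1)
        hVS (by lia) hnm (by lia)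
      rwa [hmn, hVz, hVW (by lia), hVW (by lia), hVW (by lia), hVW (by lia), hVW (by lia),
        hVW (by lia), hVW (by lia)] at this
    have hzW : z = W (N + 5) := by
      obtain ⟨j, hj | hj⟩ := Int.even_or_odd' (N + 5 : ℤ)
      · have d := hD (m := j + 1) (n := j - 1) (by lia) (by lia) (by lia)
        have e := normEDS_even b c (J * c - b ^ 4) j
        rw [← hW, ← hj] at e
        refine mul_right_cancel₀ hb ?_
        rw [show j + 1 - (j - 1) = 2 by ring, show j + 1 + 1 = j + 2 by ring,
          show j + 1 - 1 = j by ring, show j - 1 + 1 = j by ring,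
          show j - 1 - 1 = j - 2 by ring] at d
        rw [e, ← normEDS_two b c (J * c - b ^ 4), ← hW, d]
        ring
      · have d := hD (m := j + 1) (n := j) (by lia) (by lia) (by lia)
        have e := normEDS_odd b c (J * c - b ^ 4) j
        rw [← hW, ← hj] at e
        rw [show j + 1 - j = 1 by ring, show j + 1 + 1 = j + 2 by ring,
          show j + 1 - 1 = j by ring, hW, normEDS_one, mul_one, ← hW] at d
        rw [e, d]
        ring
    rw [hzW] at hzmul
    rwa [show (N : ℤ) + 3 + 2 = N + 5 by ring, show (N : ℤ) + 3 - 2 = N + 1 by ring,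
      show (N : ℤ) + 3 + 1 = N + 4 by ring, show (N : ℤ) + 3 - 1 = N + 2 by ring]

end EllipticRecurrence

/-! ### Generic relations and descent of zeros -/

section NormEDS

lemma normEDS_two_three_two (n : ℕ) : normEDS (2 : ℤ) 3 2 n = n := by
  induction n using Nat.strong_induction_on with
  | _ n ih =>
  obtain h | h := lt_or_ge n 5
  · interval_cases n <;> norm_num
  obtain ⟨m, rfl | rfl⟩ := Nat.even_or_odd' n
  · have e := normEDS_even (2 : ℤ) 3 2 m
    have h1 := ih (m - 1) (by lia)
    have h2 := ih m (by lia)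
    have h3 := ih (m + 2) (by lia)
    have h4 := ih (m - 2) (by lia)
    have h5 := ih (m + 1) (by lia)
    push_cast [show 1 ≤ m by lia, show 2 ≤ m by lia] at *
    rw [h1, h2, h3, h4, h5] at e
    linarith
  · have e := normEDS_odd (2 : ℤ) 3 2 m
    have h1 := ih (m - 1) (by lia)
    have h2 := ih m (by lia)
    have h3 := ih (m + 2) (by lia)
    have h5 := ih (m + 1) (by lia)
    push_cast [show 1 ≤ m by lia] at *
    rw [h1, h2, h3, h5] at e
    linarith

open MvPolynomial in
lemma normEDS_generic_ne_zero {k : ℤ} (hk : 1 ≤ k) :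
    normEDS (X 0) (X 1) (X 2 * X 1 - X 0 ^ 4 : MvPolynomial (Fin 3) ℤ) k ≠ 0 := by
  intro h
  -- At `b = 2`, `c = 3`, `J = 6` the sequence is `k ↦ k`.
  have := congrArg (aeval ![(2 : ℤ), 3, 6]) h
  rw [map_normEDS, map_zero] at this
  simp only [map_sub, map_mul, map_pow, aeval_X] at this
  have this : normEDS (2 : ℤ) 3 (6 * 3 - 2 ^ 4) k = 0 := this
  lift k to ℕ using by lia
  rw [show (6 * 3 - 2 ^ 4 : ℤ) = 2 by norm_num, normEDS_two_three_two] at this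
  lia

variable {R : Type*} [CommRing R]

open MvPolynomial in
lemma normEDS_somos_and_invariant (b c J : R) {k : ℤ} (hk : 2 ≤ k) :
    let W := normEDS b c (J * c - b ^ 4)
    W (k + 2) * W (k - 2) = b ^ 2 * (W (k + 1) * W (k - 1)) - c * W k ^ 2 ∧
    W (k - 1) ^ 2 * W (k + 2) + W (k + 1) ^ 2 * W (k - 2) + b ^ 2 * W k ^ 3 =
      J * (W (k - 1) * W k * W (k + 1)) := by
  let i := algebraMap (MvPolynomial (Fin 3) ℤ) (FractionRing (MvPolynomial (Fin 3) ℤ))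
  have hi : Function.Injective i := IsFractionRing.injective _ _
  let V := normEDS (X 0) (X 1) (X 2 * X 1 - X 0 ^ 4 : MvPolynomial (Fin 3) ℤ)
  have hV (k : ℤ) : i (V k) = normEDS (i (X 0)) (i (X 1)) (i (X 2) * i (X 1) - i (X 0) ^ 4) k := by
    simp [V, map_normEDS]
  have hne (k : ℤ) (hk : 1 ≤ k) :
      normEDS (i (X 0)) (i (X 1)) (i (X 2) * i (X 1) - i (X 0) ^ 4) k ≠ 0 := by
    rw [← hV, map_ne_zero_iff i hi]
    exact normEDS_generic_ne_zero hk
  have s := normEDS_somos_of_ne_zero hne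
  have t := somos_invariant (J := i (X 2)) (by simp) (by simp) (by simp) (by simp) (by simp)
    (fun k hk _ ↦ hne k hk) (fun k hk _ ↦ s k hk) hk (lt_add_one k)
  have s := s k hk
  simp only [← hV] at s t
  simp only [← map_mul, ← map_pow, ← map_sub, ← map_add] at s t
  let e := aeval (R := ℤ) ![b, c, J]
  have he (k : ℤ) : e (V k) = normEDS b c (J * c - b ^ 4) k := by
    simp [V, e, map_normEDS]
  have s := congrArg e (hi s)
  have t := congrArg e (hi t)
  simp only [map_mul, map_pow, map_sub, map_add, he] at s t
  simp only [e, aeval_X] at s t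
  exact ⟨s, t⟩

/-- If `W` is the normalised elliptic divisibility sequence with `W 4 / W 2 = J * W 3 - W 2 ^ 4`,
then two consecutive terms can only vanish if `W 2 = W 3 = 0`. -/
lemma normEDS_eq_zero_of_consecutive [IsDomain R] {b c J : R} {n : ℕ} (hn : 1 ≤ n)
    (h : normEDS b c (J * c - b ^ 4) n = 0) (h' : normEDS b c (J * c - b ^ 4) (n + 1) = 0) :
    b = 0 ∧ c = 0 := by
  induction n, hn using Nat.le_induction with
  | base => simp at h
  | succ n hn ih =>
    by_cases hW : normEDS b c (J * c - b ^ 4) n = 0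
    · exact ih hW (by exact_mod_cast h)
    obtain rfl | hn2 := hn.eq_or_lt
    · norm_num at h h'
      exact ⟨h, h'⟩
    -- With the next two terms zero, these reduce to `c * W n ^ 2 = 0` and `b ^ 2 * W n ^ 3 = 0`.
    obtain ⟨s, t⟩ := normEDS_somos_and_invariant b c J (k := n) (by lia)
    push_cast at h h'
    rw [show (n : ℤ) + 1 + 1 = n + 2 by ring] at h'
    simp only [h, h'] at s t
    constructor
    · simpa [-normEDS_ofNat, hW] using t
    · simpa [-normEDS_ofNat, hW] using s

end NormEDS

/-! ### Division polynomials at a point -/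

namespace WeierstrassCurve

open Polynomial

section Ring

variable {R : Type*} [CommRing R] (W : WeierstrassCurve R) {x y : R}

/-- Supplies `J = 6x² + b₂x + b₄`, with no division by `Ψ₃`. -/
lemma eval_preΨ₄ (x : R) : W.preΨ₄.eval x =
    (6 * x ^ 2 + W.b₂ * x + W.b₄) * W.Ψ₃.eval x - W.Ψ₂Sq.eval x ^ 2 := by
  simp [preΨ₄, Ψ₃, Ψ₂Sq, b₂, b₄, b₆, b₈]
  ring

variable {W}

lemma Affine.Equation.eval_Ψ₂Sq (h : W.toAffine.Equation x y) :
    W.Ψ₂Sq.eval x = (2 * y + W.a₁ * x + W.a₃) ^ 2 := by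
  rw [Affine.equation_iff] at h
  simp [Ψ₂Sq, b₂, b₄, b₆]
  linear_combination -4 * h

lemma Affine.Equation.eval_Ψ₃ (h : W.toAffine.Equation x y) :
    W.Ψ₃.eval x = (3 * x + W.a₂) * (2 * y + W.a₁ * x + W.a₃) ^ 2 +
      W.a₁ * (2 * y + W.a₁ * x + W.a₃) * (W.a₁ * y - (3 * x ^ 2 + 2 * W.a₂ * x + W.a₄)) -
      (W.a₁ * y - (3 * x ^ 2 + 2 * W.a₂ * x + W.a₄)) ^ 2 := by
  rw [Affine.equation_iff] at h
  simp [Ψ₃, b₂, b₄, b₆, b₈]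
  linear_combination -(W.a₁ ^ 2 + 4 * (3 * x + W.a₂)) * h

/-- `preΨ` omits the factor `ψ₂` at even indices; restoring it gives the sequence itself. -/
lemma Affine.Equation.eval_preΨ_mul (h : W.toAffine.Equation x y) (n : ℤ) :
    (W.preΨ n).eval x * (if Even n then 2 * y + W.a₁ * x + W.a₃ else 1) =
      normEDS (2 * y + W.a₁ * x + W.a₃) (W.Ψ₃.eval x) (W.preΨ₄.eval x) n := by
  rw [normEDS, preΨ, ← coe_evalRingHom, map_preNormEDS, map_pow]
  simp only [coe_evalRingHom, h.eval_Ψ₂Sq]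
  rw [← pow_mul]

lemma Affine.Equation.eval_ΨSq (h : W.toAffine.Equation x y) (n : ℤ) :
    (W.ΨSq n).eval x =
      normEDS (2 * y + W.a₁ * x + W.a₃) (W.Ψ₃.eval x) (W.preΨ₄.eval x) n ^ 2 := by
  rw [← h.eval_preΨ_mul, ΨSq]
  split_ifs <;> simp [h.eval_Ψ₂Sq, mul_pow]

lemma Affine.Equation.eval_Φ (h : W.toAffine.Equation x y) (n : ℤ) :
    (W.Φ n).eval x =
      x * normEDS (2 * y + W.a₁ * x + W.a₃) (W.Ψ₃.eval x) (W.preΨ₄.eval x) n ^ 2 -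
        normEDS (2 * y + W.a₁ * x + W.a₃) (W.Ψ₃.eval x) (W.preΨ₄.eval x) (n + 1) *
          normEDS (2 * y + W.a₁ * x + W.a₃) (W.Ψ₃.eval x) (W.preΨ₄.eval x) (n - 1) := by
  rw [← h.eval_ΨSq, ← h.eval_preΨ_mul, ← h.eval_preΨ_mul, WeierstrassCurve.Φ]
  simp only [Int.even_add_one, Int.even_sub_one]
  split_ifs <;> simp [h.eval_Ψ₂Sq]
  ring

end Ring

variable {F : Type*} [Field F] {W : WeierstrassCurve F} {x y : F}

/-- The polynomials `ΨSqₙ` and `Φₙ` of a possibly singular Weierstrass curve have no common zero at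
a nonsingular point. -/
lemma Affine.Nonsingular.eval_ΨSq_ne_zero_or_eval_Φ_ne_zero (h : W.toAffine.Nonsingular x y)
    {n : ℕ} (hn : 1 ≤ n) : (W.ΨSq n).eval x ≠ 0 ∨ (W.Φ n).eval x ≠ 0 := by
  obtain ⟨heq, hxy⟩ := (W.toAffine.nonsingular_iff' x y).mp h
  by_contra! hz
  obtain ⟨h1, h2⟩ := hz
  rw [heq.eval_ΨSq, sq_eq_zero_iff] at h1
  rw [heq.eval_Φ, h1] at h2
  have hd : W.preΨ₄.eval x = (6 * x ^ 2 + W.b₂ * x + W.b₄) * W.Ψ₃.eval x -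
      (2 * y + W.a₁ * x + W.a₃) ^ 4 := by
    rw [eval_preΨ₄, heq.eval_Ψ₂Sq]
    ring
  rw [hd] at h1 h2
  have hbc : 2 * y + W.a₁ * x + W.a₃ = 0 ∧ W.Ψ₃.eval x = 0 := by
    obtain h3 | h3 : _ ∨ _ := by simpa using h2
    · exact normEDS_eq_zero_of_consecutive hn h1 h3
    · obtain ⟨m, rfl⟩ : ∃ m, n = m + 1 := ⟨n - 1, by lia⟩
      obtain rfl | hm := m.eq_zero_or_pos
      · simp at h1
      push_cast at h1 h3
      rw [add_sub_cancel_right] at h3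
      exact normEDS_eq_zero_of_consecutive hm h3 h1
  obtain ⟨hb, hc⟩ := hbc
  -- Once `ψ₂ = 0`, `ψ₃` is minus the square of the partial derivative in `x`.
  rw [heq.eval_Ψ₃, hb] at hc
  have : W.a₁ * y - (3 * x ^ 2 + 2 * W.a₂ * x + W.a₄) = 0 := by simpa using hc
  exact hxy.elim (· this) (· hb)

end WeierstrassCurve

/-! ### Reduction modulo the maximal ideal -/

namespace EllipticCancellation

open IsDedekindDomain IsLocalRing

variable {R : Type*} [CommRing R] [IsDomain R] [IsDiscreteValuationRing R]
  {K : Type*} [Field K] [Algebra R K] [IsFractionRing R K]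

lemma val_algebraMap_nonneg (r : R) : 0 ≤ val R (algebraMap R K r) := by
  rw [val]
  split_ifs with h
  · exact le_top
  · have : WithZero.log (HeightOneSpectrum.valuation K
        (IsDiscreteValuationRing.maximalIdeal R) (algebraMap R K r)) ≤ 0 := by
      rw [← WithZero.log_one]
      refine (WithZero.log_le_log ((Valuation.ne_zero_iff _).mpr h) one_ne_zero).mpr
        (HeightOneSpectrum.valuation_le_one _ r)
    exact_mod_cast neg_nonneg.mpr this

lemma val_algebraMap_eq_zero {r : R} (hr : residue R r ≠ 0) : val R (algebraMap R K r) = 0 := by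
  have h1 : HeightOneSpectrum.valuation K (IsDiscreteValuationRing.maximalIdeal R)
      (algebraMap R K r) = 1 := by
    rw [HeightOneSpectrum.valuation_eq_one_iff_notMem]
    rwa [Ne, residue_eq_zero_iff] at hr
  have h0 : algebraMap R K r ≠ 0 := fun h ↦ by simp [h] at h1
  rw [val, if_neg h0, h1]
  simp

lemma exists_algebraMap_eq_of_intersectionZero_eq_zero {W : WeierstrassCurve K} {x y : K}
    {h : W.toAffine.Nonsingular x y} (hPO : intersectionZero R W (.some x y h) = 0) :
    ∃ r : R, algebraMap R K r = x := by
  refine IsDiscreteValuationRing.exists_lift_of_le_one ?_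
  obtain h0 | h0 := eq_or_ne (HeightOneSpectrum.valuation K
    (IsDiscreteValuationRing.maximalIdeal R) x) 0
  · simp [h0]
  · have h1 : max 0 (WithZero.log (HeightOneSpectrum.valuation K
        (IsDiscreteValuationRing.maximalIdeal R) x)) = 0 := by
      rw [intersectionZero] at hPO
      exact_mod_cast hPO
    rw [← WithZero.log_le_log h0 one_ne_zero, WithZero.log_one]
    exact max_eq_left_iff.mp h1

/-- A point with integral `x`-coordinate and nonsingular reduction is integral and reduces to an
affine nonsingular point. -/
lemma HasNonsingularReduction.exists_nonsingular {W : WeierstrassCurve K} [W.IsMinimal R] {r : R}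
    {y : K} {h : W.toAffine.Nonsingular (algebraMap R K r) y}
    (hns : HasNonsingularReduction R W (.some _ y h)) :
    ∃ t : ResidueField R, (W.reduction R).toAffine.Nonsingular (residue R r) t := by
  obtain ⟨u, ⟨i, hi⟩, hu, hred⟩ := hns
  obtain ⟨l, hl⟩ : ∃ l : Kˣ, l • (fun i ↦ algebraMap R K (u i)) = ![algebraMap R K r, y, 1] :=
    Quotient.exact hu
  have hinj := IsFractionRing.injective R K
  have h0 : (l : K) * algebraMap R K (u 0) = algebraMap R K r := congrFun hl 0
  have h1 : (l : K) * algebraMap R K (u 1) = y := congrFun hl 1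
  have h2 : (l : K) * algebraMap R K (u 2) = 1 := congrFun hl 2
  have hu2 : algebraMap R K (u 2) ≠ 0 := right_ne_zero_of_mul_eq_one h2
  have hu0 : u 0 = r * u 2 := by
    apply hinj
    rw [map_mul, ← h0]
    linear_combination -algebraMap R K (u 0) * h2
  have hy : y * algebraMap R K (u 2) = algebraMap R K (u 1) := by
    rw [← h1]
    linear_combination algebraMap R K (u 1) * h2
  let I := W.integralModel R
  have heq : u 1 ^ 2 + I.a₁ * r * u 2 * u 1 + I.a₃ * u 1 * u 2 =
      u 2 ^ 2 * (r ^ 3 + I.a₂ * r ^ 2 + I.a₄ * r + I.a₆) := by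
    apply hinj
    have e := (W.toAffine.equation_iff _ _).mp h.1
    simp only [map_add, map_mul, map_pow, ← hy, I, W.integralModel_a₁_eq R,
      W.integralModel_a₂_eq R, W.integralModel_a₃_eq R, W.integralModel_a₄_eq R,
      W.integralModel_a₆_eq R]
    linear_combination algebraMap R K (u 2) ^ 2 * e
  -- As `u 0 = r * u 2`, if `u 2` reduced to zero then so would `u 0`, and the equation would force
  -- the same for `u 1`, leaving no unit coordinate.
  have hz : residue R (u 2) ≠ 0 := by
    intro hz
    have hy0 : residue R (u 1) = 0 := by
      have := congrArg (residue R) heq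
      simpa [hz] using this
    have hx0 : residue R (u 0) = 0 := by rw [hu0, map_mul, hz, mul_zero]
    refine (hi.map (residue R)).ne_zero ?_
    fin_cases i
    · exact hx0
    · exact hy0
    · exact hz
  have := (WeierstrassCurve.Projective.nonsingular_of_Z_ne_zero hz).mp hred
  rw [hu0, map_mul, mul_div_cancel_right₀ _ hz] at this
  exact ⟨_, this⟩

lemma cancellationExponent_algebraMap_eq_zero (W : WeierstrassCurve K) [W.IsMinimal R] {r : R}
    {t : ResidueField R} (h : (W.reduction R).toAffine.Nonsingular (residue R r) t) {n : ℕ}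
    (hn : 1 ≤ n) : cancellationExponent R W n (algebraMap R K r) = 0 := by
  let I := W.integralModel R
  have hΨ : (W.ΨSq n).eval (algebraMap R K r) = algebraMap R K ((I.ΨSq n).eval r) := by
    rw [← W.baseChange_integralModel_eq R, WeierstrassCurve.baseChange,
      WeierstrassCurve.map_ΨSq, Polynomial.eval_map, Polynomial.eval₂_at_apply]
  have hΦ : (W.Φ n).eval (algebraMap R K r) = algebraMap R K ((I.Φ n).eval r) := by
    rw [← W.baseChange_integralModel_eq R, WeierstrassCurve.baseChange,
      WeierstrassCurve.map_Φ, Polynomial.eval_map, Polynomial.eval₂_at_apply]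
  have key := h.eval_ΨSq_ne_zero_or_eval_Φ_ne_zero hn
  rw [WeierstrassCurve.reduction, WeierstrassCurve.map_ΨSq, WeierstrassCurve.map_Φ,
    Polynomial.eval_map, Polynomial.eval₂_at_apply, Polynomial.eval_map, Polynomial.eval₂_at_apply] at key
  rw [cancellationExponent, hΨ, hΦ]
  obtain key | key := key
  · rw [val_algebraMap_eq_zero key]
    exact min_eq_left (val_algebraMap_nonneg _)
  · rw [val_algebraMap_eq_zero key]
    exact min_eq_right (val_algebraMap_nonneg _)

end EllipticCancellation

theorem mainTheorem5 (R : Type*) [CommRing R] [IsDomain R] [IsDiscreteValuationRing R]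
    {K : Type*} [Field K] [Algebra R K] [IsFractionRing R K]
    (W : WeierstrassCurve K) [W.IsElliptic] [W.IsMinimal R]
    (x y : K) (h : W.toAffine.Nonsingular x y)
    (hns : EllipticCancellation.HasNonsingularReduction R W (.some x y h))
    (hPO : EllipticCancellation.intersectionZero R W (.some x y h) = 0)
    (n : ℕ) (hn : 1 ≤ n) :
    EllipticCancellation.cancellationExponent R W n x = 0 := by
  obtain ⟨r, rfl⟩ := EllipticCancellation.exists_algebraMap_eq_of_intersectionZero_eq_zero hPO
  obtain ⟨t, ht⟩ := hns.exists_nonsingular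
  exact EllipticCancellation.cancellationExponent_algebraMap_eq_zero W ht hn
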